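/- For integers $n, v \ge 0$ and a real $q \ge 0$, consider the following two-player problem. Alice and Bob receive sets $E_A$ and $E_B$, respectively, of $n$-element subsets (hyperedges) of a common vertex set $V$ with $|V| = v$, where $|E_A| \le q$ and $|E_B| \le q$. They must find a two-coloring $\chi : V \to \{\mathrm{Red}, \mathrm{Blue}\}$ that is valid for the hypergraph $(V, E_A \cup E_B)$, that is, such that no hyperedge in $E_A \cup E_B$ is monochromatic. The players are deterministic and computationally unbounded and alternately send each other bit strings, Alice starting. In each round first Alice and then Bob has a turn; in an $r$-round protocol one of the two players announces, instead of sending a message, a valid coloring at her or his turn in the $r$-th round. Let $C_r(v, q, n)$ be the minimum, over all $r$-round protocols that are correct on all inputs, of the maximum length in bits of a single message, over all inputs. **Theorem.** For $v = \mathrm{poly}(n)$, $$C_2\left(v, \tfrac{2^n}{8}, n\right) = \mathrm{poly}(n).$$ That is, for every polynomial $p$ there is a polynomial $P$ such that $C_2(v, 2^n/8, n) \le P(n)$ for all $n$ and all $v \le p(n)$. Moreover, the same bound holds for protocols with exactly two messages, in which Alice sends one message to Bob, Bob sends one message back, and Alice then announces the coloring. -/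

import Mathlib

namespace HypergraphGame

/-- A message is a finite string of bits. -/
abbrev Msg := List Bool

/-- A deterministic two-player protocol with inputs `x : X` for Alice, `y : Y` for Bob and outputs
in `Z`. Alice moves first and the players alternate. The player to move sees her or his own input
and the list of all messages exchanged so far (oldest first), and either sends a message to the
other player (`Sum.inl`) or ends the run by announcing an output (`Sum.inr`). The players are
computationally unbounded: the two strategies are arbitrary functions. -/
structure Protocol (X Y Z : Type) where
  alice : X → List Msg → Msg ⊕ Z
  bob : Y → List Msg → Msg ⊕ Z

namespace Protocol

variable {X Y Z : Type}

/-- What happens on inputs `x`, `y` after the messages in `h`: Alice is to move after an even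
number of messages, Bob after an odd number. -/
def action (π : Protocol X Y Z) (x : X) (y : Y) (h : List Msg) : Msg ⊕ Z :=
  if Even h.length then π.alice x h else π.bob y h

/-- `π.Reaches x y h`: in the run of `π` on inputs `x`, `y` the first `h.length` messages are
those in `h`. -/
inductive Reaches (π : Protocol X Y Z) (x : X) (y : Y) : List Msg → Prop
  | nil : Reaches π x y []
  | snoc {h : List Msg} {m : Msg} (hh : Reaches π x y h) (hm : π.action x y h = Sum.inl m) :
      Reaches π x y (h ++ [m])

/-- On inputs `x`, `y` the protocol stops with output `z` after exactly the messages in `h`. -/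
def Halts (π : Protocol X Y Z) (x : X) (y : Y) (h : List Msg) (z : Z) : Prop :=
  π.Reaches x y h ∧ π.action x y h = Sum.inr z

/-- The protocol solves the relation `R`, and on every pair of inputs the number of messages that
are sent before the output belongs to `S`. -/
def Solves (π : Protocol X Y Z) (R : X → Y → Z → Prop) (S : Set ℕ) : Prop :=
  ∀ x y, ∃ h z, π.Halts x y h z ∧ R x y z ∧ h.length ∈ S

/-- The largest length of a message that is sent, over all pairs of inputs. -/
noncomputable def cost (π : Protocol X Y Z) : ℕ∞ :=
  ⨆ (x : X) (y : Y) (h : List Msg) (_ : π.Reaches x y h) (m : Msg) (_ : m ∈ h), (m.length : ℕ∞)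

end Protocol

/-- The least cost of a protocol that solves `R` and in which the number of messages belongs
to `S` on every pair of inputs (`⊤` if there is no such protocol). -/
noncomputable def complexity {X Y Z : Type} (R : X → Y → Z → Prop) (S : Set ℕ) : ℕ∞ :=
  ⨅ (π : Protocol X Y Z) (_ : π.Solves R S), π.cost

/-- The `r`-round complexity of `R`. In each round first Alice, then Bob has a turn; the output is
announced in the `r`-th round, by Alice at her turn (after `2 * r - 2` messages) or by Bob at
his turn (after `2 * r - 1` messages). -/
noncomputable def roundComplexity {X Y Z : Type} (R : X → Y → Z → Prop) (r : ℕ) : ℕ∞ :=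
  complexity R {t | t / 2 + 1 = r}

/-- The `t`-message complexity of `R`: exactly `t` messages are sent, Alice sending the first one,
and the receiver of the last one announces the output. -/
noncomputable def messageComplexity {X Y Z : Type} (R : X → Y → Z → Prop) (t : ℕ) : ℕ∞ :=
  complexity R {t}

/-- The input of a player: at most `q` hyperedges, all of size `n`, on the vertex set `Fin v`. -/
structure EdgeSet (v n : ℕ) (q : ℝ) where
  edges : Finset (Finset (Fin v))
  uniform : ∀ e ∈ edges, e.card = n
  card_le : (edges.card : ℝ) ≤ q

/-- A two-coloring `χ` is valid if no hyperedge is monochromatic. -/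
def IsValidColoring {v : ℕ} (E : Finset (Finset (Fin v))) (χ : Fin v → Bool) : Prop :=
  ∀ e ∈ E, ∃ i ∈ e, ∃ j ∈ e, χ i ≠ χ j

/-- The two-player hypergraph coloring problem: find a two-coloring of the vertices that is valid
for the union of the two sets of hyperedges. -/
def HGame (v n : ℕ) (q : ℝ) (A B : EdgeSet v n q) (χ : Fin v → Bool) : Prop :=
  IsValidColoring (A.edges ∪ B.edges) χ

end HypergraphGame

namespace HypergraphGame

/-! A random coloring is invalid for one player's edges with probability at most `1/4`: each edge is
monochromatic with probability at most `2 / 2 ^ n`. Alice sends `4 * t` colorings, `t = v + 1`, such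
that every xor-shift leaves fewer than `3 * t` of them invalid for her (`exists_shifts`, a union
bound). By averaging, Bob finds a shift leaving at most `t` invalid for him (`exists_shift`). Hence
some shifted coloring suits both; Bob sends the shift and marks the indices valid for him, and Alice
picks a marked one valid for her. -/

open Finset

/-! ### Counting invalid colorings and choosing shifts -/

section Counting

/-- At most `2 ^ (v + 1 - n)` colorings are monochromatic on a given set of `n` vertices. -/
theorem card_monochromatic_le {v n : ℕ} (e : Finset (Fin v)) (he : e.card = n) :
    2 ^ n * #{χ : Fin v → Bool | ∀ i ∈ e, ∀ j ∈ e, χ i = χ j} ≤ 2 * 2 ^ v := by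
  classical
  have hinj : #{χ : Fin v → Bool | ∀ i ∈ e, ∀ j ∈ e, χ i = χ j} ≤
      #(univ : Finset (Bool × ({x // x ∉ e} → Bool))) := by
    refine card_le_card_of_injOn
      (fun χ => (if h : e.Nonempty then χ h.choose else false, fun x => χ x.1))
      (fun _ _ => mem_coe.2 (mem_univ _)) ?_
    intro χ hχ ψ hψ h
    simp only [coe_filter, mem_univ, true_and, Set.mem_ofPred_eq] at hχ hψ
    obtain ⟨h₁, h₂⟩ := Prod.mk.inj h
    funext x
    by_cases hx : x ∈ e
    · have hne : e.Nonempty := ⟨x, hx⟩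
      rw [dif_pos hne, dif_pos hne] at h₁
      rw [hχ x hx _ hne.choose_spec, hψ x hx _ hne.choose_spec, h₁]
    · exact congrFun h₂ ⟨x, hx⟩
  have hc : Fintype.card {x // x ∉ e} = v - n := by
    rw [Fintype.card_subtype_compl, Fintype.card_fin, Fintype.card_coe, he]
  have hn : n ≤ v := by
    rw [← he]
    simpa using card_le_univ e
  rw [card_univ, Fintype.card_prod, Fintype.card_fun, Fintype.card_bool, hc] at hinj
  calc _ ≤ 2 ^ n * (2 * 2 ^ (v - n)) := Nat.mul_le_mul_left _ hinj
    _ = 2 * (2 ^ n * 2 ^ (v - n)) := by ring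
    _ = 2 * 2 ^ v := by rw [← pow_add, Nat.add_sub_cancel' hn]

open Classical in
/-- At most a quarter of all colorings are invalid for a family of at most `2 ^ n / 8` edges. -/
theorem card_invalid_le {v n : ℕ} (E : EdgeSet v n ((2 : ℝ) ^ n / 8)) :
    4 * #{χ : Fin v → Bool | ¬ IsValidColoring E.edges χ} ≤ 2 ^ v := by
  have hsub : ({χ : Fin v → Bool | ¬ IsValidColoring E.edges χ} : Finset _) ⊆
      E.edges.biUnion fun e => {χ : Fin v → Bool | ∀ i ∈ e, ∀ j ∈ e, χ i = χ j} := by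
    intro χ hχ
    simpa [IsValidColoring] using hχ
  have hcard : 8 * #E.edges ≤ 2 ^ n := by
    have h : (8 : ℝ) * #E.edges ≤ 2 ^ n := by linarith [E.card_le]
    exact_mod_cast h
  have hsum : 2 ^ n * #{χ : Fin v → Bool | ¬ IsValidColoring E.edges χ} ≤
      #E.edges * (2 * 2 ^ v) := by
    refine (Nat.mul_le_mul_left _ ((card_le_card hsub).trans card_biUnion_le)).trans ?_
    rw [mul_sum, ← smul_eq_mul (#E.edges)]
    exact sum_le_card_nsmul _ _ _ fun e he => card_monochromatic_le e (E.uniform e he)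
  refine Nat.le_of_mul_le_mul_left ?_ (pow_pos two_pos n : 0 < 2 ^ n)
  calc _ = 4 * (2 ^ n * #{χ : Fin v → Bool | ¬ IsValidColoring E.edges χ}) := by ring
    _ ≤ 4 * (#E.edges * (2 * 2 ^ v)) := Nat.mul_le_mul_left _ hsum
    _ = 8 * #E.edges * 2 ^ v := by ring
    _ ≤ 2 ^ n * 2 ^ v := Nat.mul_le_mul_right _ hcard

variable {G : Type*} [Fintype G] [DecidableEq G]

theorem card_preimage_injective_le {f : G → G} (hf : Function.Injective f) (D : Finset G) :
    #{a | f a ∈ D} ≤ #D :=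
  card_le_card_of_injOn f (fun a ha => by simpa using ha) hf.injOn

/-- If `D` has density at most `1 / 4`, then some `4 * t` elements are such that no common shift
moves `3 * t` of them into `D`. -/
theorem exists_shifts [Nonempty G] (f : G → G → G) (hf : ∀ b, Function.Injective fun a => f a b)
    (D : Finset G) (hD : 4 * #D ≤ Fintype.card G) (t : ℕ) (ht : Fintype.card G < 2 ^ (2 * t)) :
    ∃ α : Fin (4 * t) → G, ∀ b, #{i | f (α i) b ∈ D} < 3 * t := by
  by_contra! hcon
  set N := Fintype.card G with hN
  -- Each tuple fails through a shift and `3 * t` indices sent into `D`; a given such pair accounts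
  -- for at most a fraction `4 ^ (-3 * t)` of all tuples.
  have hcover : (univ : Finset (Fin (4 * t) → G)) ⊆
      ((univ : Finset G) ×ˢ powersetCard (3 * t) (univ : Finset (Fin (4 * t)))).biUnion fun p =>
        Fintype.piFinset fun i => if i ∈ p.2 then ({a | f a p.1 ∈ D} : Finset G) else univ := by
    intro α _
    obtain ⟨b, hb⟩ := hcon α
    obtain ⟨S, hS, hcard⟩ := exists_subset_card_eq hb
    refine mem_biUnion.2 ⟨(b, S), ?_, ?_⟩
    · simpa using hcard
    · refine Fintype.mem_piFinset.2 fun i => ?_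
      split_ifs with hi
      · simpa using hS hi
      · exact mem_univ _
  have hpiece : ∀ p ∈ (univ : Finset G) ×ˢ powersetCard (3 * t) (univ : Finset (Fin (4 * t))),
      2 ^ (6 * t) * #(Fintype.piFinset fun i =>
        if i ∈ p.2 then ({a | f a p.1 ∈ D} : Finset G) else univ) ≤ N ^ (4 * t) := by
    intro p hp
    have hp' : #p.2 = 3 * t := (mem_powersetCard.1 (mem_product.1 hp).2).2
    have hcompl : #(univ.filter fun i => i ∉ p.2) = t := by
      rw [filter_not, filter_mem_eq_inter, univ_inter, ← compl_eq_univ_sdiff, card_compl, hp',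
        Fintype.card_fin]
      omega
    rw [Fintype.card_piFinset]
    simp only [apply_ite card]
    rw [prod_ite, prod_const, prod_const, hcompl, filter_mem_eq_inter, univ_inter, hp', card_univ,
      ← hN]
    calc _ = (4 * #{a | f a p.1 ∈ D}) ^ (3 * t) * N ^ t := by
          rw [mul_pow, show 6 * t = 2 * (3 * t) by ring, pow_mul]
          norm_num [mul_assoc]
      _ ≤ N ^ (3 * t) * N ^ t := by
          gcongr
          exact (Nat.mul_le_mul_left _ (card_preimage_injective_le (hf p.1) D)).trans hD
      _ = N ^ (4 * t) := by
          rw [← pow_add, show 3 * t + t = 4 * t by ring]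
  have hcount : 2 ^ (6 * t) * N ^ (4 * t) ≤ N * 2 ^ (4 * t) * N ^ (4 * t) := by
    have h₁ : N ^ (4 * t) = #(univ : Finset (Fin (4 * t) → G)) := by
      rw [card_univ, Fintype.card_fun, Fintype.card_fin]
    have h₂ : #((univ : Finset G) ×ˢ powersetCard (3 * t) (univ : Finset (Fin (4 * t)))) ≤
        N * 2 ^ (4 * t) := by
      rw [card_product, card_univ, card_powersetCard, card_univ, Fintype.card_fin]
      exact Nat.mul_le_mul_left _ (Nat.choose_le_two_pow _ _)
    refine (Nat.mul_le_mul_left _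
      (h₁.le.trans ((card_le_card hcover).trans card_biUnion_le))).trans ?_
    rw [mul_sum]
    refine (sum_le_card_nsmul _ _ _ hpiece).trans ?_
    rw [smul_eq_mul]
    exact Nat.mul_le_mul_right _ h₂
  have hpos : 0 < N ^ (4 * t) := pow_pos Fintype.card_pos _
  have h := Nat.le_of_mul_le_mul_right hcount hpos
  -- Cancelling `2 ^ (4 * t)`, the bound on the number of index sets, leaves `2 ^ (2 * t) ≤ N`.
  rw [show 6 * t = 2 * t + 4 * t by ring, pow_add] at h
  exact absurd (Nat.le_of_mul_le_mul_right h (by positivity)) (not_le.2 ht)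

/-- If `D` has density at most `1 / 4`, then some shift moves at most a quarter of `4 * t` given
elements into `D`. -/
theorem exists_shift [Nonempty G] (f : G → G → G) (hf : ∀ a, Function.Injective (f a))
    (D : Finset G) (hD : 4 * #D ≤ Fintype.card G) {t : ℕ} (α : Fin (4 * t) → G) :
    ∃ b, #{i | f (α i) b ∈ D} ≤ t := by
  by_contra! hcon
  -- Double counting: the mean over `b` is at most `t`.
  have hswap : ∑ b, #{i | f (α i) b ∈ D} = ∑ i, #{b | f (α i) b ∈ D} :=
    sum_card_bipartiteAbove_eq_sum_card_bipartiteBelow (fun b i => f (α i) b ∈ D)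
  have hlow : Fintype.card G * t < ∑ b, #{i | f (α i) b ∈ D} := by
    rw [← smul_eq_mul, ← card_univ, ← sum_const]
    exact sum_lt_sum_of_nonempty univ_nonempty fun b _ => hcon b
  have hup : ∑ i, #{b | f (α i) b ∈ D} ≤ 4 * t * #D := by
    refine (sum_le_card_nsmul _ _ _ fun i _ => card_preimage_injective_le (hf (α i)) D).trans ?_
    simp
  have : 4 * #D * t ≤ Fintype.card G * t := Nat.mul_le_mul_right _ hD
  rw [hswap] at hlow
  linarith [hlow.trans_le hup, mul_right_comm 4 #D t]

end Counting

/-! ### Two-message protocols -/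

section TwoMessages

/-- The word of bits that lists the values of a function on a finite type. -/
noncomputable def encodeBits {ι : Type} [Fintype ι] (f : ι → Bool) : Msg :=
  List.ofFn (f ∘ (Fintype.equivFin ι).symm)

theorem length_encodeBits {ι : Type} [Fintype ι] (f : ι → Bool) :
    (encodeBits f).length = Fintype.card ι := by
  simp [encodeBits]

theorem encodeBits_injective {ι : Type} [Fintype ι] :
    Function.Injective (encodeBits : (ι → Bool) → Msg) := fun _ _ h =>
  (Fintype.equivFin ι).symm.surjective.injective_comp_right (List.ofFn_injective h)

/-- The inverse of `encodeBits`. -/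
noncomputable def decodeBits {ι : Type} [Fintype ι] : Msg → ι → Bool :=
  Function.invFun encodeBits

theorem decodeBits_encodeBits {ι : Type} [Fintype ι] (f : ι → Bool) :
    decodeBits (encodeBits f) = f :=
  Function.leftInverse_invFun encodeBits_injective f

variable {X Y Z ι κ : Type} [Fintype ι] [Fintype κ]

/-- The protocol in which Alice sends `a x`, Bob replies `b y (a x)`, and Alice then
announces `c x (b y (a x))`. -/
noncomputable def twoMessageProtocol (a : X → ι → Bool) (b : Y → (ι → Bool) → κ → Bool)
    (c : X → (κ → Bool) → Z) : Protocol X Y Z where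
  alice x
    | [_, m] => Sum.inr (c x (decodeBits m))
    | _ => Sum.inl (encodeBits (a x))
  bob y h := Sum.inl (encodeBits (b y (decodeBits h.headI)))

variable (a : X → ι → Bool) (b : Y → (ι → Bool) → κ → Bool) (c : X → (κ → Bool) → Z)

theorem action_twoMessageProtocol (x : X) (y : Y) (m₁ m₂ : Msg) :
    (twoMessageProtocol a b c).action x y [m₁, m₂] = Sum.inr (c x (decodeBits m₂)) := by
  simp [Protocol.action, twoMessageProtocol]

theorem reaches_twoMessageProtocol {x : X} {y : Y} {h : List Msg}
    (hh : (twoMessageProtocol a b c).Reaches x y h) :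
    h = [] ∨ h = [encodeBits (a x)] ∨ h = [encodeBits (a x), encodeBits (b y (a x))] := by
  induction hh with
  | nil => exact Or.inl rfl
  | snoc hh hm ih =>
    rcases ih with rfl | rfl | rfl
    · have := Sum.inl.inj hm
      subst this
      exact Or.inr (Or.inl rfl)
    · have : encodeBits (b y (decodeBits (encodeBits (a x)))) = _ := Sum.inl.inj hm
      rw [decodeBits_encodeBits] at this
      subst this
      exact Or.inr (Or.inr rfl)
    · exact absurd ((action_twoMessageProtocol a b c x y _ _).symm.trans hm) Sum.inr_ne_inl

theorem halts_twoMessageProtocol (x : X) (y : Y) :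
    (twoMessageProtocol a b c).Halts x y [encodeBits (a x), encodeBits (b y (a x))]
      (c x (b y (a x))) := by
  have h₁ : (twoMessageProtocol a b c).Reaches x y ([] ++ [encodeBits (a x)]) :=
    .snoc .nil rfl
  refine ⟨.snoc h₁ ?_, ?_⟩
  · change Sum.inl (encodeBits (b y (decodeBits (encodeBits (a x))))) = _
    rw [decodeBits_encodeBits]
  · rw [action_twoMessageProtocol, decodeBits_encodeBits]

/-- Keeping `S` general lets one protocol bound both the round and the message complexity. -/
theorem complexity_le_of_twoMessages {R : X → Y → Z → Prop} {S : Set ℕ} (hS : 2 ∈ S) {L : ℕ}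
    (hι : Fintype.card ι ≤ L) (hκ : Fintype.card κ ≤ L) (hR : ∀ x y, R x y (c x (b y (a x)))) :
    complexity R S ≤ L := by
  refine (iInf₂_le (twoMessageProtocol a b c) fun x y =>
    ⟨_, _, halts_twoMessageProtocol a b c x y, hR x y, hS⟩).trans ?_
  refine iSup_le fun x => iSup_le fun y => iSup_le fun h => iSup_le fun hh =>
    iSup_le fun m => iSup_le fun hm => ?_
  have hlen : m.length ≤ L := by
    rcases reaches_twoMessageProtocol a b c hh with rfl | rfl | rfl
    · simp at hm
    · obtain rfl : m = _ := by simpa using hm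
      rwa [length_encodeBits]
    · rcases (by simpa using hm : m = _ ∨ m = _) with rfl | rfl <;> rwa [length_encodeBits]
  exact_mod_cast hlen

end TwoMessages

/-! ### The coloring protocol -/

theorem isValidColoring_union {v : ℕ} {E F : Finset (Finset (Fin v))} {χ : Fin v → Bool}
    (hE : IsValidColoring E χ) (hF : IsValidColoring F χ) : IsValidColoring (E ∪ F) χ :=
  fun e he => (mem_union.1 he).elim (hE e) (hF e)

/-- The bound is the sum of the two message lengths, `4 * (v + 1) * v` and `v + 4 * (v + 1)`. -/
theorem complexity_hGame_le (v n : ℕ) {S : Set ℕ} (hS : 2 ∈ S) :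
    complexity (HGame v n ((2 : ℝ) ^ n / 8)) S ≤ ((4 * v ^ 2 + 9 * v + 4 : ℕ) : ℕ∞) := by
  classical
  let f : (Fin v → Bool) → (Fin v → Bool) → Fin v → Bool := fun α β x => xor (α x) (β x)
  have hf₁ : ∀ β, Function.Injective fun α => f α β := fun β α α' h =>
    funext fun x => (Bool.xor_left_inj (z := β x)).1 (congrFun h x)
  have hf₂ : ∀ α, Function.Injective (f α) := fun α β β' h =>
    funext fun x => (Bool.xor_right_inj (x := α x)).1 (congrFun h x)
  have hbad (E : EdgeSet v n ((2 : ℝ) ^ n / 8)) :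
      4 * #{χ : Fin v → Bool | ¬ IsValidColoring E.edges χ} ≤ Fintype.card (Fin v → Bool) := by
    simpa using card_invalid_le E
  have hsize : Fintype.card (Fin v → Bool) < 2 ^ (2 * (v + 1)) := by
    rw [Fintype.card_fun, Fintype.card_bool, Fintype.card_fin]
    exact Nat.pow_lt_pow_right one_lt_two (by omega)
  choose α hα using fun A : EdgeSet v n ((2 : ℝ) ^ n / 8) =>
    exists_shifts f hf₁ _ (hbad A) (v + 1) hsize
  choose β hβ using fun B : EdgeSet v n ((2 : ℝ) ^ n / 8) =>
    exists_shift f hf₂ _ (hbad B) (t := v + 1)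
  let reply (B : EdgeSet v n ((2 : ℝ) ^ n / 8)) (m : Fin (4 * (v + 1)) × Fin v → Bool) :
      Fin v ⊕ Fin (4 * (v + 1)) → Bool :=
    Sum.elim (β B (Function.curry m))
      fun i => decide (IsValidColoring B.edges (f (Function.curry m i) (β B (Function.curry m))))
  have hex : ∀ A B, ∃ i, reply B (Function.uncurry (α A)) (Sum.inr i) = true ∧
      IsValidColoring A.edges (f (α A i) (reply B (Function.uncurry (α A)) ∘ Sum.inl)) := by
    intro A B
    by_contra! hcon
    have hA := hα A (β B (α A))
    have hB := hβ B (α A)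
    -- Otherwise all `4 * t` indices are bad for Alice (fewer than `3 * t`) or for Bob (at most
    -- `t`).
    have hcover : (univ : Finset (Fin (4 * (v + 1)))) ⊆
        ({i | f (α A i) (β B (α A)) ∈ ({χ | ¬ IsValidColoring A.edges χ} : Finset _)} : Finset _) ∪
        ({i | f (α A i) (β B (α A)) ∈ ({χ | ¬ IsValidColoring B.edges χ} : Finset _)} :
          Finset _) := by
      intro i _
      simp only [mem_union, mem_filter, mem_univ, true_and]
      by_cases hi : IsValidColoring B.edges (f (α A i) (β B (α A)))
      · exact Or.inl (hcon i (decide_eq_true hi))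
      · exact Or.inr hi
    have h := (card_le_card hcover).trans (card_union_le _ _)
    rw [card_univ, Fintype.card_fin] at h
    omega
  let answer (A : EdgeSet v n ((2 : ℝ) ^ n / 8)) (r : Fin v ⊕ Fin (4 * (v + 1)) → Bool) :
      Fin v → Bool :=
    -- By `hex`, the `else` branch never occurs on Bob's actual replies.
    if h : ∃ i, r (Sum.inr i) = true ∧ IsValidColoring A.edges (f (α A i) (r ∘ Sum.inl))
    then f (α A h.choose) (r ∘ Sum.inl) else r ∘ Sum.inl
  refine complexity_le_of_twoMessages (fun A => Function.uncurry (α A)) reply answer hS ?_ ?_ ?_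
  · simp only [Fintype.card_prod, Fintype.card_fin]
    nlinarith
  · simp only [Fintype.card_sum, Fintype.card_fin]
    nlinarith
  · intro A B
    have h := hex A B
    simp only [answer, dif_pos h]
    exact isValidColoring_union h.choose_spec.2 (of_decide_eq_true h.choose_spec.1)

end HypergraphGame

theorem mainTheorem5 :
    ∀ p : Polynomial ℕ, ∃ P : Polynomial ℕ, ∀ n v : ℕ, v ≤ p.eval n →
      HypergraphGame.roundComplexity
          (HypergraphGame.HGame v n ((2 : ℝ) ^ n / 8)) 2 ≤ ((P.eval n : ℕ) : ℕ∞) ∧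
      HypergraphGame.messageComplexity
          (HypergraphGame.HGame v n ((2 : ℝ) ^ n / 8)) 2 ≤ ((P.eval n : ℕ) : ℕ∞) := by
  intro p
  refine ⟨4 * p ^ 2 + 9 * p + 4, fun n v hv => ?_⟩
  have hle : 4 * v ^ 2 + 9 * v + 4 ≤ (4 * p ^ 2 + 9 * p + 4).eval n := by
    simp only [Polynomial.eval_add, Polynomial.eval_mul, Polynomial.eval_pow,
      Polynomial.eval_ofNat]
    gcongr
  have hle' : ((4 * v ^ 2 + 9 * v + 4 : ℕ) : ℕ∞) ≤
      (((4 * p ^ 2 + 9 * p + 4).eval n : ℕ) : ℕ∞) := Nat.cast_le.2 hle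
  exact ⟨(HypergraphGame.complexity_hGame_le v n (by simp)).trans hle',
    (HypergraphGame.complexity_hGame_le v n (Set.mem_singleton 2)).trans hle'⟩
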